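/- An $R$-graph, for a finite set $R$ of positive integers, is a hypergraph $G=(V,E)$ with finite vertex set $V$ and $E\subseteq 2^V$ such that $|e|\in R$ for all $e\in E$. If $G$ has $n$ vertices, its Lubell value is $h_n(G)=\sum_{e\in E}\binom{n}{|e|}^{-1}$. For a family $\mathcal F$ of $R$-graphs let $\pi(\mathcal F)=\lim_{n\to\infty}\pi_n(\mathcal F)$, where $\pi_n(\mathcal F)$ is the maximum of $h_n(G)$ over all $R$-graphs $G$ on $n$ vertices that contain no member of $\mathcal F$ as a (not necessarily induced) subgraph. (This limit exists; the maximum over an empty set of graphs is read as $0$.) The Lagrangian of an $R$-graph $F$ with vertex set $\{1,\dots,n\}$, $n\ge 1$, is $$\lambda(F)=\max\Big\{\sum_{e\in E(F)}|e|!\prod_{i\in e}x_i \;:\; x_i\ge 0,\ \sum_{i=1}^n x_i=1\Big\},$$ and $\lambda(F)=0$ if $F$ has no vertices. A number $\alpha\in[0,|R|]$ is a jump for $R$ if there is $c>0$ such that for every $\epsilon>0$ and every integer $t\ge\max R$ there is $n_0$ such that every $R$-graph $G$ on $n\ge n_0$ vertices with $h_n(G)\ge\alpha+\epsilon$ has a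 subgraph $H$ on $t$ vertices with $h_t(H)\ge\alpha+c$. It is a strong jump for $R$ if there is $c>0$ such that for every integer $t\ge\max R$ there is $n_0$ such that every $R$-graph $G$ on $n\ge n_0$ vertices with $h_n(G)\ge\alpha-c$ has a subgraph $H$ on $t$ vertices with $h_t(H)\ge\alpha+c$. **Theorem.** Let $R$ be a finite set of positive integers and let $\alpha\in[0,|R|)$. Then $\alpha$ is a jump for $R$ if and only if there is a finite nonempty family $\mathcal F$ of $R$-graphs such that (i) $\pi(\mathcal F)\le\alpha$ and (ii) $\min_{F\in\mathcal F}\lambda(F)>\alpha$. Moreover, $\alpha$ is a strong jump for $R$ if and only if there is a finite nonempty family $\mathcal F$ of $R$-graphs such that (i') $\pi(\mathcal F)<\alpha$ and (ii) $\min_{F\in\mathcal F}\lambda(F)>\alpha$. -/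

import Mathlib

open Filter Topology

noncomputable section

/-- An `R`-graph on the vertex set `{0, …, n - 1}`: a set of edges (vertex subsets), each of which
has its cardinality in `R`. -/
@[ext]
structure RGraph (R : Finset ℕ) (n : ℕ) where
  /-- the edge set -/
  edges : Finset (Finset (Fin n))
  /-- all edge sizes lie in `R` -/
  card_mem : ∀ e ∈ edges, e.card ∈ R

namespace RGraph

variable {R : Finset ℕ}

/-- The Lubell function `h_n(G) = ∑_{e ∈ E(G)} 1 / binom(n, |e|)`. -/
def lubell {n : ℕ} (G : RGraph R n) : ℝ :=
  ∑ e ∈ G.edges, 1 / (n.choose e.card : ℝ)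

/-- `F.IsContained G`: the hypergraph `G` has a (not necessarily induced) subgraph
that is a copy of `F`. -/
def IsContained {m n : ℕ} (F : RGraph R m) (G : RGraph R n) : Prop :=
  ∃ φ : Fin m ↪ Fin n, ∀ e ∈ F.edges, e.map φ ∈ G.edges

/-- `G` is `𝓕`-free: it contains no member of the family `𝓕`. -/
def IsFree (𝓕 : Set (Σ m, RGraph R m)) {n : ℕ} (G : RGraph R n) : Prop :=
  ∀ F ∈ 𝓕, ¬ F.2.IsContained G

/-- `π_n(𝓕)`: the maximum of `h_n(G)` over the `𝓕`-free `R`-graphs `G` on `n` vertices. -/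
def turanMax (𝓕 : Set (Σ m, RGraph R m)) (n : ℕ) : ℝ :=
  sSup {h : ℝ | ∃ G : RGraph R n, G.IsFree 𝓕 ∧ G.lubell = h}

/-- The Turán density `π(𝓕) = lim_{n → ∞} π_n(𝓕)`. The limit exists, see
`RGraph.tendsto_turanMax`. -/
def turanDensity (𝓕 : Set (Σ m, RGraph R m)) : ℝ :=
  limUnder atTop (turanMax 𝓕)

/-- The polynomial form `λ(F, x) = ∑_{e ∈ E(F)} |e|! ∏_{i ∈ e} x_i`. -/
def polyForm {n : ℕ} (F : RGraph R n) (x : Fin n → ℝ) : ℝ :=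
  ∑ e ∈ F.edges, (e.card.factorial : ℝ) * ∏ i ∈ e, x i

/-- The Lagrangian `λ(F)`: the maximum of the polynomial form over the standard simplex. The
maximum is attained as soon as there is a vertex, see `RGraph.isGreatest_lagrangian`. -/
def lagrangian {n : ℕ} (F : RGraph R n) : ℝ :=
  sSup (F.polyForm '' stdSimplex ℝ (Fin n))

/-- `α` is a jump for `R`. -/
def IsJump (R : Finset ℕ) (α : ℝ) : Prop :=
  ∃ c : ℝ, 0 < c ∧ ∀ ε : ℝ, 0 < ε → ∀ t : ℕ, R.sup id ≤ t →
    ∃ n₀ : ℕ, ∀ n : ℕ, n₀ ≤ n → ∀ G : RGraph R n, α + ε ≤ G.lubell →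
      ∃ H : RGraph R t, H.IsContained G ∧ α + c ≤ H.lubell

/-- `α` is a strong jump for `R`. -/
def IsStrongJump (R : Finset ℕ) (α : ℝ) : Prop :=
  ∃ c : ℝ, 0 < c ∧ ∀ t : ℕ, R.sup id ≤ t →
    ∃ n₀ : ℕ, ∀ n : ℕ, n₀ ≤ n → ∀ G : RGraph R n, α - c ≤ G.lubell →
      ∃ H : RGraph R t, H.IsContained G ∧ α + c ≤ H.lubell

/-! The maximum and the limit in the definitions above are attained and exist, respectively. -/

theorem isGreatest_lagrangian {n : ℕ} (hn : 0 < n) (F : RGraph R n) :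
    IsGreatest (F.polyForm '' stdSimplex ℝ (Fin n)) F.lagrangian := by
  have hne : (stdSimplex ℝ (Fin n)).Nonempty := ⟨_, single_mem_stdSimplex ℝ (⟨0, hn⟩ : Fin n)⟩
  have hc : Continuous F.polyForm := by unfold polyForm; fun_prop
  exact ((isCompact_stdSimplex ℝ (Fin n)).image hc).isGreatest_sSup (hne.image _)

theorem lubell_nonneg {n : ℕ} (G : RGraph R n) : 0 ≤ G.lubell :=
  Finset.sum_nonneg fun _ _ => by positivity

theorem finite_lubell (𝓕 : Set (Σ m, RGraph R m)) (n : ℕ) :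
    {h : ℝ | ∃ G : RGraph R n, G.IsFree 𝓕 ∧ G.lubell = h}.Finite := by
  have : Finite (RGraph R n) :=
    Finite.of_injective (fun G : RGraph R n => G.edges) fun _ _ h => RGraph.ext h
  exact (Set.toFinite {G : RGraph R n | G.IsFree 𝓕}).image lubell

theorem isGreatest_turanMax (𝓕 : Set (Σ m, RGraph R m)) (n : ℕ)
    (h : ∃ G : RGraph R n, G.IsFree 𝓕) :
    IsGreatest {h : ℝ | ∃ G : RGraph R n, G.IsFree 𝓕 ∧ G.lubell = h} (turanMax 𝓕 n) := by
  obtain ⟨G, hG⟩ := h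
  exact ⟨Set.Nonempty.csSup_mem ⟨_, G, hG, rfl⟩ (finite_lubell 𝓕 n),
    fun _ hx => le_csSup (finite_lubell 𝓕 n).bddAbove hx⟩

theorem turanMax_nonneg (𝓕 : Set (Σ m, RGraph R m)) (n : ℕ) : 0 ≤ turanMax 𝓕 n := by
  refine Real.sSup_nonneg ?_
  rintro _ ⟨G, -, rfl⟩
  exact G.lubell_nonneg

/-- Deletion of a vertex. -/
def del {n : ℕ} (G : RGraph R (n + 1)) (v : Fin (n + 1)) : RGraph R n where
  edges := Finset.univ.filter fun e => e.map v.succAboveEmb ∈ G.edges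
  card_mem e he := by
    have := G.card_mem _ (Finset.mem_filter.1 he).2
    rwa [Finset.card_map] at this

theorem isFree_del {𝓕 : Set (Σ m, RGraph R m)} {n : ℕ} {G : RGraph R (n + 1)}
    (hG : G.IsFree 𝓕) (v : Fin (n + 1)) : (G.del v).IsFree 𝓕 := by
  rintro F hF ⟨φ, hφ⟩
  refine hG F hF ⟨φ.trans v.succAboveEmb, fun e he => ?_⟩
  have := (Finset.mem_filter.1 (hφ e he)).2
  rwa [Finset.map_map] at this

theorem lubell_del {n : ℕ} (G : RGraph R (n + 1)) (v : Fin (n + 1)) :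
    (G.del v).lubell = ∑ e ∈ G.edges with v ∉ e, 1 / (n.choose e.card : ℝ) := by
  classical
  have : (G.del v).edges.map (Finset.mapEmbedding v.succAboveEmb).toEmbedding
      = G.edges.filter fun e => v ∉ e := by
    ext e
    simp only [del, Finset.mem_map, Finset.mem_filter, Finset.mem_univ, true_and]
    constructor
    · rintro ⟨a, ha, rfl⟩
      refine ⟨ha, ?_⟩
      simp [Fin.succAbove_ne]
    · rintro ⟨he, hv⟩
      have key : (Finset.univ.filter fun i => v.succAbove i ∈ e).map v.succAboveEmb = e := by
        ext j
        simp only [Finset.mem_map, Finset.mem_filter, Finset.mem_univ, true_and,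
          Fin.coe_succAboveEmb]
        constructor
        · rintro ⟨i, hi, rfl⟩
          exact hi
        · intro hj
          obtain ⟨i, rfl⟩ := Fin.exists_succAbove_eq (x := j) (y := v) (by rintro rfl; exact hv hj)
          exact ⟨i, hj, rfl⟩
      exact ⟨_, by rw [key]; exact he, key⟩
  rw [← this, Finset.sum_map]
  simp [lubell, Finset.card_map]

theorem sum_lubell_del {n : ℕ} (hn : R.sup id ≤ n) (G : RGraph R (n + 1)) :
    ∑ v, (G.del v).lubell = ∑ _v : Fin (n + 1), G.lubell := by
  classical
  simp_rw [lubell_del, Finset.sum_filter]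
  rw [Finset.sum_comm, Finset.sum_const, lubell, Finset.smul_sum]
  refine Finset.sum_congr rfl fun e he => ?_
  have hk : e.card ≤ n := (Finset.le_sup (f := id) (G.card_mem e he)).trans hn
  rw [← Finset.sum_filter, Finset.sum_const]
  have hcard : (Finset.univ.filter fun v => v ∉ e).card = n + 1 - e.card := by
    rw [← Finset.compl_filter, Finset.card_compl]; simp
  rw [hcard, Finset.card_univ, Fintype.card_fin, nsmul_eq_mul, nsmul_eq_mul]
  have h1 : (n.choose e.card : ℝ) ≠ 0 := by exact_mod_cast (Nat.choose_pos hk).ne'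
  have h2 : ((n + 1).choose e.card : ℝ) ≠ 0 := by
    exact_mod_cast (Nat.choose_pos (hk.trans n.le_succ)).ne'
  have h3 : (n.choose e.card : ℝ) * ((n + 1 : ℕ) : ℝ)
      = ((n + 1).choose e.card : ℝ) * ((n + 1 - e.card : ℕ) : ℝ) := by
    exact_mod_cast Nat.choose_mul_succ_eq n e.card
  field_simp
  linarith

theorem turanMax_succ_le (𝓕 : Set (Σ m, RGraph R m)) {n : ℕ} (hn : R.sup id ≤ n) :
    turanMax 𝓕 (n + 1) ≤ turanMax 𝓕 n := by
  refine Real.sSup_le ?_ (turanMax_nonneg 𝓕 n)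
  rintro _ ⟨G, hG, rfl⟩
  obtain ⟨v, -, hv⟩ := Finset.exists_le_of_sum_le Finset.univ_nonempty (sum_lubell_del hn G).ge
  exact hv.trans (le_csSup (finite_lubell 𝓕 n).bddAbove ⟨_, isFree_del hG v, rfl⟩)

/-- The limit that defines the Turán density exists. -/
theorem tendsto_turanMax (𝓕 : Set (Σ m, RGraph R m)) :
    Tendsto (turanMax 𝓕) atTop (𝓝 (turanDensity 𝓕)) := by
  refine tendsto_nhds_limUnder ?_
  have hanti : Antitone fun n => turanMax 𝓕 (n + R.sup id) := by
    refine antitone_nat_of_succ_le fun n => ?_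
    rw [add_right_comm]
    exact turanMax_succ_le 𝓕 (Nat.le_add_left _ _)
  have hbdd : BddBelow (Set.range fun n => turanMax 𝓕 (n + R.sup id)) :=
    ⟨0, by rintro _ ⟨n, rfl⟩; exact turanMax_nonneg _ _⟩
  exact ⟨_, (tendsto_add_atTop_iff_nat _).1 (tendsto_atTop_ciInf hanti hbdd)⟩

end RGraph

end

/-!
Everything rests on pulling a hypergraph `F` back along a map `φ` from `{0, …, t - 1}` to its
vertices (`RGraph.comap`), which yields induced subgraphs for injective `φ` and blow-ups in general.
Two averages are exact. Over a uniformly random embedding, the expected Lubell value of the pullback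
is the Lubell value of the hypergraph (`sum_lubell_comap_embedding`). Over a map that sends the points
independently to vertices distributed according to `x`, it is the polynomial form `λ(F, x)`
(`sum_prod_image_eq`); with an optimal `x`, some blow-up on `t` vertices has Lubell value at least
`λ(F)` (`exists_lagrangian_le_lubell_comap`), for each `t ≥ max R`.

From a family to a (strong) jump: let `h(G) ≥ β > π(𝓕)` with `G` large. The first average, for a
fixed `T` with `π_T(𝓕) < β`, shows that a positive proportion of the `T`-tuples of vertices of `G`
span a copy of one and the same member of `𝓕` in the same position. A dense set of tuples contains a
product of large sets (`exists_box_of_dense`), so `G` contains all the blow-ups of this member on `t`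
vertices (`exists_forall_comap_isContained`), and one of them has Lubell value at least
`min λ(F) > α`. For a jump `β = α + ε`; for a strong jump `β` lies between `π(𝓕)` and `α`.

From a (strong) jump to a family: take all the `R`-graphs on `t` vertices with Lubell value at least
`α + c`. The bound on the Turán density is the definition of a (strong) jump. Evaluating the
polynomial form at the barycentre gives `λ(H) ≥ (1 - O(1/t)) h_t(H)` (`mul_lubell_le_lagrangian`), so
the Lagrangians exceed `α` once `t` is large (`exists_family`).
-/

namespace RGraph

variable {R : Finset ℕ}

/-! ### Pullbacks and averaging -/

/-- The pullback of the hypergraph `F` along a map `φ` from `{0, …, t - 1}` to its vertices: the edges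
are the sets that `φ` maps injectively onto an edge of `F`. For injective `φ` this is an induced
subgraph of `F`; in general it is a blow-up of an induced subgraph, the vertex `i` being replaced by
the class `φ ⁻¹ {i}`. -/
def comap {t m : ℕ} (F : RGraph R m) (φ : Fin t → Fin m) : RGraph R t where
  edges := Finset.univ.filter fun e => (e.image φ).card = e.card ∧ e.image φ ∈ F.edges
  card_mem e he := by
    obtain ⟨h1, h2⟩ := (Finset.mem_filter.1 he).2
    exact h1 ▸ F.card_mem _ h2

theorem mem_edges_comap {t m : ℕ} {F : RGraph R m} {φ : Fin t → Fin m} {e : Finset (Fin t)} :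
    e ∈ (F.comap φ).edges ↔ (e.image φ).card = e.card ∧ e.image φ ∈ F.edges := by
  simp [comap]

theorem lubell_comap {t m : ℕ} (F : RGraph R m) (φ : Fin t → Fin m) :
    (F.comap φ).lubell = ∑ f ∈ F.edges,
      ∑ e ∈ Finset.univ.powersetCard f.card,
        if e.image φ = f then 1 / (t.choose f.card : ℝ) else 0 := by
  rw [lubell, ← Finset.sum_fiberwise_of_maps_to (g := Finset.image φ) (t := F.edges)
    fun e he => (mem_edges_comap.1 he).2]
  refine Finset.sum_congr rfl fun f hf => ?_
  rw [← Finset.sum_filter]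
  have : (F.comap φ).edges.filter (fun e => e.image φ = f)
      = (Finset.univ.powersetCard f.card).filter fun e => e.image φ = f := by
    ext e
    simp only [Finset.mem_filter, mem_edges_comap, Finset.mem_powersetCard_univ]
    constructor
    · rintro ⟨⟨h1, -⟩, rfl⟩
      exact ⟨h1.symm, rfl⟩
    · rintro ⟨h1, rfl⟩
      exact ⟨⟨h1.symm, hf⟩, rfl⟩
  rw [this]
  refine Finset.sum_congr rfl fun e he => ?_
  rw [Finset.mem_powersetCard_univ.1 (Finset.mem_filter.1 he).1]

/-- Averaging principle: if in a weighted family of maps `Φ ω` the total weight `c f` of the maps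
that carry a set `e` onto a set `f` of the same size does not depend on `e`, then the weighted sum of
the Lubell values of the pullbacks is the sum of `c` over the edges. -/
theorem sum_mul_lubell_comap {Ω : Type*} [Fintype Ω] {t m : ℕ} (ht : R.sup id ≤ t)
    (F : RGraph R m) (Φ : Ω → Fin t → Fin m) (W : Ω → ℝ) (c : Finset (Fin m) → ℝ)
    (h : ∀ (e : Finset (Fin t)) (f : Finset (Fin m)), e.card = f.card →
      ∑ ω with e.image (Φ ω) = f, W ω = c f) :
    ∑ ω, W ω * (F.comap (Φ ω)).lubell = ∑ f ∈ F.edges, c f := by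
  simp_rw [lubell_comap, Finset.mul_sum]
  rw [Finset.sum_comm]
  refine Finset.sum_congr rfl fun f hf => ?_
  rw [Finset.sum_comm]
  have hk : f.card ≤ t := (Finset.le_sup (f := id) (F.card_mem f hf)).trans ht
  have h1 : (t.choose f.card : ℝ) ≠ 0 := by exact_mod_cast (Nat.choose_pos hk).ne'
  have key : ∀ e ∈ Finset.univ.powersetCard f.card,
      (∑ ω, W ω * if e.image (Φ ω) = f then 1 / (t.choose f.card : ℝ) else 0)
        = c f / (t.choose f.card : ℝ) := by
    intro e he
    rw [← h e f (Finset.mem_powersetCard_univ.1 he), Finset.sum_filter, Finset.sum_div]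
    refine Finset.sum_congr rfl fun ω _ => ?_
    split_ifs <;> simp [div_eq_mul_inv]
  rw [Finset.sum_congr rfl key, Finset.sum_const, Finset.card_powersetCard, Finset.card_univ,
    Fintype.card_fin, nsmul_eq_mul]
  field_simp

theorem exists_perm_image_eq {n : ℕ} {f g : Finset (Fin n)} (h : f.card = g.card) :
    ∃ σ : Equiv.Perm (Fin n), f.image σ = g := by
  let e : {x // x ∈ f} ≃ {x // x ∈ g} := Finset.equivOfCardEq h
  refine ⟨e.extendSubtype, Finset.eq_of_subset_of_card_le ?_ ?_⟩
  · intro y hy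
    obtain ⟨x, hx, rfl⟩ := Finset.mem_image.1 hy
    exact e.extendSubtype_mem x hx
  · rw [Finset.card_image_of_injective _ (Equiv.injective _), h]

/-- The images of a fixed `k`-set under the embeddings of `{0, …, t - 1}` are uniformly distributed
among the `k`-sets. -/
theorem card_embedding_image_eq {t n : ℕ} (e : Finset (Fin t)) (f : Finset (Fin n))
    (h : e.card = f.card) :
    ((Finset.univ.filter fun w : Fin t ↪ Fin n => e.image w = f).card : ℝ)
      = (Fintype.card (Fin t ↪ Fin n) : ℝ) / (n.choose f.card : ℝ) := by
  have hk : f.card ≤ n := by simpa using Finset.card_le_univ f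
  have h1 : (n.choose f.card : ℝ) ≠ 0 := by exact_mod_cast (Nat.choose_pos hk).ne'
  rw [eq_div_iff h1]
  have h2 := Finset.card_eq_sum_card_fiberwise (s := (Finset.univ : Finset (Fin t ↪ Fin n)))
    (f := fun w : Fin t ↪ Fin n => e.image w) (t := Finset.univ.powersetCard f.card) (by
      intro w _
      simp [Finset.card_image_of_injective _ w.injective, h])
  have h3 : ∀ g ∈ Finset.univ.powersetCard f.card,
      (Finset.univ.filter fun w : Fin t ↪ Fin n => e.image w = g).card
        = (Finset.univ.filter fun w : Fin t ↪ Fin n => e.image w = f).card := by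
    intro g hg
    obtain ⟨σ, rfl⟩ := exists_perm_image_eq (Finset.mem_powersetCard_univ.1 hg)
    refine Finset.card_bij (fun w _ => w.trans σ.toEmbedding) ?_ ?_ ?_
    · intro w hw
      rw [Finset.mem_filter] at hw ⊢
      refine ⟨Finset.mem_univ _, ?_⟩
      rw [← hw.2, Finset.image_image]
      rfl
    · intro w _ w' _ hww
      ext i
      have := DFunLike.congr_fun hww i
      simpa using congrArg Fin.val (σ.injective this)
    · intro w hw
      refine ⟨w.trans σ.symm.toEmbedding, ?_, ?_⟩
      · rw [Finset.mem_filter] at hw ⊢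
        refine ⟨Finset.mem_univ _, Finset.image_injective σ.injective ?_⟩
        rw [← hw.2, Finset.image_image]
        congr 1
        ext i
        simp
      · ext i
        simp
  rw [Finset.sum_congr rfl h3, Finset.sum_const, Finset.card_powersetCard, Finset.card_univ,
    Finset.card_univ, Fintype.card_fin, smul_eq_mul] at h2
  rw [h2]
  push_cast
  ring

theorem sum_lubell_comap_embedding {t n : ℕ} (ht : R.sup id ≤ t) (G : RGraph R n) :
    ∑ w : Fin t ↪ Fin n, (G.comap w).lubell = Fintype.card (Fin t ↪ Fin n) * G.lubell := by
  have := sum_mul_lubell_comap ht G (fun w : Fin t ↪ Fin n => ⇑w) (fun _ => 1)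
    (fun f => (Fintype.card (Fin t ↪ Fin n) : ℝ) / (n.choose f.card : ℝ)) (fun e f h => by
      rw [← card_embedding_image_eq e f h]
      simp)
  simp only [one_mul] at this
  rw [this, lubell, Finset.mul_sum]
  simp [div_eq_mul_inv]

/-- If the vertices of `e` are sent to independent random points with distribution `x`, the image
is a given set `f` of the same size with probability `|f|! ∏ i ∈ f, x i`: this sums the weight over
the `|f|!` bijections from `e` to `f`. -/
theorem sum_prod_image_eq {t m : ℕ} {x : Fin m → ℝ} (hx : ∑ i, x i = 1) (e : Finset (Fin t))
    (f : Finset (Fin m)) (h : e.card = f.card) :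
    ∑ φ : Fin t → Fin m with e.image φ = f, ∏ a, x (φ a)
      = (f.card.factorial : ℝ) * ∏ i ∈ f, x i := by
  classical
  -- each map carrying `e` onto `f` restricts to exactly one bijection
  have h1 : ∀ φ : Fin t → Fin m, (if e.image φ = f then ∏ a, x (φ a) else 0)
      = ∑ σ : e ≃ f, ∏ a, (x (φ a) * if ∀ ha : a ∈ e, (σ ⟨a, ha⟩ : Fin m) = φ a then 1 else 0) := by
    intro φ
    simp_rw [Finset.prod_mul_distrib, ← Finset.mul_sum, Finset.prod_ite_zero, Finset.prod_const_one]
    split_ifs with hφ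
    · have hinj : Set.InjOn φ e := Finset.card_image_iff.1 (by rw [hφ, h])
      let τ : e ≃ f := Equiv.ofBijective
        (fun a => ⟨φ a, hφ ▸ Finset.mem_image_of_mem φ a.2⟩) (by
          constructor
          · intro a b hab
            exact Subtype.ext (hinj a.2 b.2 (congrArg Subtype.val hab))
          · rintro ⟨i, hi⟩
            rw [← hφ] at hi
            obtain ⟨a, ha, rfl⟩ := Finset.mem_image.1 hi
            exact ⟨⟨a, ha⟩, rfl⟩)
      rw [Finset.sum_eq_single τ]
      · rw [if_pos, mul_one]
        exact fun a _ ha => rfl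
      · intro σ _ hσ
        refine if_neg fun hc => hσ ?_
        ext a
        exact congrArg Fin.val (hc a (Finset.mem_univ _) a.2)
      · simp
    · rw [Finset.sum_eq_zero, mul_zero]
      intro σ _
      refine if_neg fun hc => hφ ?_
      refine Finset.eq_of_subset_of_card_le ?_ ?_ |>.symm
      · intro i hi
        refine Finset.mem_image.2 ⟨σ.symm ⟨i, hi⟩, (σ.symm ⟨i, hi⟩).2, ?_⟩
        rw [← hc _ (Finset.mem_univ _) (σ.symm ⟨i, hi⟩).2]
        simp
      · exact Finset.card_image_le.trans h.le
  rw [Finset.sum_filter, Finset.sum_congr rfl fun φ _ => h1 φ, Finset.sum_comm]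
  have h2 : ∀ σ : e ≃ f, ∑ φ : Fin t → Fin m,
      ∏ a, (x (φ a) * if ∀ ha : a ∈ e, (σ ⟨a, ha⟩ : Fin m) = φ a then 1 else 0)
        = ∏ i ∈ f, x i := by
    intro σ
    have := Finset.prod_univ_sum (fun _ : Fin t => (Finset.univ : Finset (Fin m)))
      (fun a i => x i * if ∀ ha : a ∈ e, (σ ⟨a, ha⟩ : Fin m) = i then (1 : ℝ) else 0)
    rw [Fintype.piFinset_univ] at this
    rw [← this, ← Finset.prod_coe_sort f, ← σ.prod_comp (fun i => x i),
      Finset.prod_coe_sort_eq_attach, Finset.prod_attach_eq_prod_dite]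
    refine Finset.prod_congr rfl fun a _ => ?_
    split_ifs with ha
    · simp [ha]
    · simp [ha, hx]
  rw [Finset.sum_congr rfl fun σ _ => h2 σ, Finset.sum_const, Finset.card_univ, nsmul_eq_mul,
    Fintype.card_equiv (Finset.equivOfCardEq h), Fintype.card_coe, h]

/-- A random map to the vertices of `F`, distributed according to an optimal weighting, pulls `F`
back to a hypergraph with expected Lubell value `λ(F)`; so some pullback has at least this value. -/
theorem exists_lagrangian_le_lubell_comap {t m : ℕ} (ht : R.sup id ≤ t) (hm : 0 < m)
    (F : RGraph R m) : ∃ φ : Fin t → Fin m, F.lagrangian ≤ (F.comap φ).lubell := by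
  obtain ⟨⟨x, ⟨hx0, hx1⟩, hx⟩, -⟩ := isGreatest_lagrangian hm F
  have h1 : ∑ φ : Fin t → Fin m, (∏ a, x (φ a)) * (F.comap φ).lubell = F.lagrangian := by
    rw [sum_mul_lubell_comap ht F (fun φ => φ) _ _ fun e f h => sum_prod_image_eq hx1 e f h, ← hx]
    rfl
  have h2 : ∑ φ : Fin t → Fin m, (∏ a, x (φ a)) = 1 := by
    have := Finset.prod_univ_sum (fun _ : Fin t => (Finset.univ : Finset (Fin m))) fun _ i => x i
    rw [Fintype.piFinset_univ] at this
    simp [← this, hx1]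
  by_contra! hlt
  have h3 : ∀ φ : Fin t → Fin m, 0 ≤ ∏ a, x (φ a) := fun φ => Finset.prod_nonneg fun a _ => hx0 _
  have h4 : ∑ φ : Fin t → Fin m, (∏ a, x (φ a)) * (F.comap φ).lubell
      < ∑ φ : Fin t → Fin m, (∏ a, x (φ a)) * F.lagrangian := by
    obtain ⟨φ, -, hφ⟩ := Finset.exists_ne_zero_of_sum_ne_zero (by rw [h2]; exact one_ne_zero)
    exact Finset.sum_lt_sum (fun ψ _ => mul_le_mul_of_nonneg_left (hlt ψ).le (h3 ψ))
      ⟨φ, Finset.mem_univ _, mul_lt_mul_of_pos_left (hlt φ) (lt_of_le_of_ne (h3 φ) hφ.symm)⟩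
  rw [h1, ← Finset.sum_mul, h2, one_mul] at h4
  exact h4.false

/-! ### Products in dense sets of tuples -/

/-- A reverse Markov inequality: a bounded function with a large sum is large at many points. -/
theorem sum_le_card_filter_mul_add {ι : Type*} (s : Finset ι) (g : ι → ℝ) {M b : ℝ} (hb : 0 ≤ b)
    (hM : ∀ i ∈ s, g i ≤ M) :
    ∑ i ∈ s, g i ≤ ((s.filter fun i => b < g i).card : ℝ) * M + s.card * b := by
  rw [← Finset.sum_filter_add_sum_filter_not s fun i => b < g i]
  refine add_le_add ?_ ?_
  · rw [← nsmul_eq_mul]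
    exact Finset.sum_le_card_nsmul _ _ _ fun i hi => hM i (Finset.mem_filter.1 hi).1
  · refine (Finset.sum_le_card_nsmul _ _ b fun i hi => not_lt.1 (Finset.mem_filter.1 hi).2).trans ?_
    rw [nsmul_eq_mul]
    gcongr
    exact Finset.filter_subset _ _

/-- A dense set of `m`-tuples contains a product of `m` sets of size `t` (the theorem of Erdős on
complete `m`-partite `m`-uniform hypergraphs, for ordered tuples). In the induction step, a bounded
number `M` of first coordinates of large degree is fixed; many tails are joined to at least `t` of
them, and by pigeonhole many tails are joined to the same ones. -/
theorem exists_box_of_dense (t m : ℕ) {δ : ℝ} (hδ : 0 < δ) :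
    ∃ n₀ : ℕ, ∀ n : ℕ, n₀ ≤ n → ∀ A : Finset (Fin m → Fin n), δ * (n : ℝ) ^ m ≤ A.card →
      ∃ u : Fin m → (Fin t ↪ Fin n), ∀ s : Fin m → Fin t, (fun i => u i (s i)) ∈ A := by
  classical
  induction m generalizing δ with
  | zero =>
    refine ⟨0, fun n _ A hA => ⟨fun i => i.elim0, fun s => ?_⟩⟩
    have : 0 < A.card := by
      rw [pow_zero, mul_one] at hA
      exact_mod_cast hδ.trans_le hA
    obtain ⟨a, ha⟩ := Finset.card_pos.1 this
    rwa [Subsingleton.elim (fun i => _) a]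
  | succ m ih =>
    obtain ⟨M, hM⟩ := exists_nat_gt (4 * t / δ)
    have hM0 : (0 : ℝ) < M := lt_of_le_of_lt (by positivity) hM
    have hMt : (t : ℝ) ≤ M * (δ / 4) := by
      rw [div_lt_iff₀ hδ] at hM
      linarith
    obtain ⟨n₁, hn₁⟩ := ih (δ := δ / 4 / 2 ^ M) (by positivity)
    obtain ⟨n₂, hn₂⟩ := exists_nat_gt (M / (δ / 2))
    refine ⟨max n₁ (max n₂ 1), fun n hn A hA => ?_⟩
    simp only [max_le_iff] at hn
    have hn0 : (0 : ℝ) < n := by exact_mod_cast hn.2.2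
    have hMn : (M : ℝ) ≤ n * (δ / 2) := by
      have : (n₂ : ℝ) ≤ n := by exact_mod_cast hn.2.1
      have := hn₂.trans_le this
      rw [div_lt_iff₀ (by positivity)] at this
      exact this.le
    let D : Fin n → Finset (Fin m → Fin n) := fun v =>
      Finset.univ.filter fun x => (Fin.cons v x : Fin (m + 1) → Fin n) ∈ A
    have hN : ((Finset.univ : Finset (Fin m → Fin n)).card : ℝ) = (n : ℝ) ^ m := by simp
    have hAsum : (A.card : ℝ) = ∑ v, ((D v).card : ℝ) := by
      have h := Finset.card_eq_sum_card_fiberwise (s := A) (f := fun x => x 0)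
        (t := Finset.univ) (by simp)
      rw [h]
      push_cast
      refine Finset.sum_congr rfl fun v _ => ?_
      congr 1
      refine (Finset.card_bij (fun x _ => Fin.cons v x) ?_ ?_ ?_).symm
      · intro x hx
        simpa [D] using hx
      · intro x _ y _ hxy
        exact Fin.cons_right_injective (α := fun _ => Fin n) v hxy
      · intro y hy
        obtain ⟨hy1, rfl⟩ := Finset.mem_filter.1 hy
        exact ⟨Fin.tail y, by simpa [D, Fin.cons_self_tail] using hy1, Fin.cons_self_tail y⟩
    -- the vertices whose degree is at least half the average
    have hV := sum_le_card_filter_mul_add Finset.univ (fun v => ((D v).card : ℝ))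
      (M := (n : ℝ) ^ m) (b := δ / 2 * (n : ℝ) ^ m) (by positivity) (fun v _ => by
        rw [← hN]
        exact_mod_cast Finset.card_le_univ _)
    rw [← hAsum, Finset.card_univ, Fintype.card_fin] at hV
    set V := Finset.univ.filter fun v => δ / 2 * (n : ℝ) ^ m < ((D v).card : ℝ) with hVdef
    have hVcard : (M : ℝ) ≤ V.card := by
      have h1 : (n : ℝ) * (δ / 2) * (n : ℝ) ^ m ≤ V.card * (n : ℝ) ^ m := by
        rw [pow_succ] at hA
        nlinarith
      exact hMn.trans (le_of_mul_le_mul_right h1 (by positivity))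
    obtain ⟨S, hSV, hSM⟩ := Finset.exists_subset_card_eq (s := V) (n := M) (by exact_mod_cast hVcard)
    let N : (Fin m → Fin n) → Finset (Fin n) := fun x =>
      S.filter fun v => (Fin.cons v x : Fin (m + 1) → Fin n) ∈ A
    have hdc : ∑ x, ((N x).card : ℝ) = ∑ v ∈ S, ((D v).card : ℝ) := by
      have := Finset.sum_card_bipartiteAbove_eq_sum_card_bipartiteBelow (s := S)
        (t := (Finset.univ : Finset (Fin m → Fin n)))
        fun v x => (Fin.cons v x : Fin (m + 1) → Fin n) ∈ A
      exact_mod_cast this.symm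
    have hlow : (M : ℝ) * (δ / 2 * (n : ℝ) ^ m) ≤ ∑ v ∈ S, ((D v).card : ℝ) := by
      rw [← hSM, ← nsmul_eq_mul]
      exact Finset.card_nsmul_le_sum _ _ _ fun v hv => (Finset.mem_filter.1 (hSV hv)).2.le
    have hX := sum_le_card_filter_mul_add Finset.univ (fun x => ((N x).card : ℝ))
      (M := M) (b := t) (by positivity) (fun x _ => by
        rw [← hSM]
        exact_mod_cast Finset.card_filter_le _ _)
    rw [hdc, hN] at hX
    set X := Finset.univ.filter fun x => (t : ℝ) < ((N x).card : ℝ) with hXdef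
    have hXcard : δ / 4 * (n : ℝ) ^ m ≤ X.card := by
      have h1 : (n : ℝ) ^ m * t ≤ (n : ℝ) ^ m * (M * (δ / 4)) := by gcongr
      have h2 : δ / 4 * (n : ℝ) ^ m * M ≤ X.card * M := by nlinarith
      exact le_of_mul_le_mul_right h2 hM0
    obtain ⟨T, hT, hTcard⟩ := Finset.exists_le_card_fiber_of_nsmul_le_card_of_maps_to
      (s := X) (t := S.powerset) (f := N) (b := δ / 4 / 2 ^ M * (n : ℝ) ^ m)
      (fun x _ => Finset.mem_powerset.2 (Finset.filter_subset _ _))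
      ⟨∅, Finset.empty_mem_powerset _⟩ (by
        rw [Finset.card_powerset, hSM, nsmul_eq_mul]
        push_cast
        calc (2 : ℝ) ^ M * (δ / 4 / 2 ^ M * (n : ℝ) ^ m) = δ / 4 * (n : ℝ) ^ m := by
              field_simp
          _ ≤ _ := hXcard)
    obtain ⟨u, hu⟩ := hn₁ n hn.1 _ hTcard
    have hTt : t ≤ T.card := by
      have hpos : (0 : ℝ) < (X.filter fun x => N x = T).card :=
        lt_of_lt_of_le (by positivity) hTcard
      obtain ⟨x, hx⟩ := Finset.card_pos.1 (by exact_mod_cast hpos)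
      obtain ⟨hx1, rfl⟩ := Finset.mem_filter.1 hx
      exact_mod_cast (Finset.mem_filter.1 hx1).2.le
    obtain ⟨T', hT', hT'card⟩ := Finset.exists_subset_card_eq hTt
    -- the fixed set of first coordinates, followed by the box found among the tails
    refine ⟨Fin.cons (T'.orderEmbOfFin hT'card).toEmbedding u, fun s => ?_⟩
    have h1 := (Finset.mem_filter.1 (hu (Fin.tail s))).2
    have h2 : T'.orderEmbOfFin hT'card (s 0) ∈ T := hT' (Finset.orderEmbOfFin_mem _ _ _)
    rw [← h1] at h2
    have h3 := (Finset.mem_filter.1 h2).2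
    convert h3 using 1
    ext i
    refine Fin.cases ?_ (fun j => ?_) i <;> simp [Fin.tail]

/-! ### Supersaturation and blow-ups -/

/-- If the product of the sets `range (u i)` consists of injective tuples whose restrictions along
`ψ` are copies of `F` in `G`, then `G` contains every blow-up of `F` with classes inside these
sets. -/
theorem comap_isContained_of_box {t m T n : ℕ} (ht : 0 < t) {F : RGraph R m} {G : RGraph R n}
    (ψ : Fin m ↪ Fin T) (u : Fin T → (Fin t ↪ Fin n))
    (hinj : ∀ s : Fin T → Fin t, Function.Injective fun i => u i (s i))
    (hG : ∀ s : Fin T → Fin t, ∀ e ∈ F.edges, e.image (fun i => u (ψ i) (s (ψ i))) ∈ G.edges)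
    (φ : Fin t → Fin m) : (F.comap φ).IsContained G := by
  classical
  have : Nonempty (Fin t) := ⟨⟨0, ht⟩⟩
  refine ⟨⟨fun a => u (ψ (φ a)) a, fun a b hab => ?_⟩, fun e he => ?_⟩
  · dsimp only at hab
    by_cases h : ψ (φ a) = ψ (φ b)
    · rw [h] at hab
      exact (u _).injective hab
    · refine (h (hinj (fun i => if i = ψ (φ a) then a else b) ?_)).elim
      simp only [if_true, if_neg (Ne.symm h)]
      exact hab
  · obtain ⟨h1, h2⟩ := mem_edges_comap.1 he
    have hφ : Set.InjOn (fun a => ψ (φ a)) e := fun a ha b hb hab =>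
      Finset.card_image_iff.1 h1 ha hb (ψ.injective hab)
    -- the tuple that takes the vertex `a` of `e` in its own coordinate `ψ (φ a)`
    have := hG (Function.invFunOn (fun a => ψ (φ a)) (e : Set (Fin t))) _ h2
    rw [Finset.image_image] at this
    rw [Finset.map_eq_image]
    convert this using 1
    refine Finset.image_congr fun a ha => ?_
    have h3 := hφ.leftInvOn_invFunOn ha
    simp only [Function.comp_apply, h3]
    rfl

theorem lubell_eq_sum_card {n : ℕ} (G : RGraph R n) :
    G.lubell = ∑ k ∈ R, ((G.edges.filter fun e => e.card = k).card : ℝ) / (n.choose k : ℝ) := by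
  rw [lubell, ← Finset.sum_fiberwise_of_maps_to (g := Finset.card) (t := R) G.card_mem]
  refine Finset.sum_congr rfl fun k _ => ?_
  rw [Finset.sum_congr rfl fun e he => by rw [(Finset.mem_filter.1 he).2], Finset.sum_const,
    nsmul_eq_mul, mul_one_div]

theorem lubell_le_card {n : ℕ} (G : RGraph R n) : G.lubell ≤ R.card := by
  rw [lubell_eq_sum_card, ← mul_one (R.card : ℝ), ← nsmul_eq_mul]
  refine Finset.sum_le_card_nsmul _ _ _ fun k _ => div_le_one_of_le₀ ?_ (by positivity)
  have : (G.edges.filter fun e => e.card = k) ⊆ Finset.univ.powersetCard k := fun e he =>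
    Finset.mem_powersetCard_univ.2 (Finset.mem_filter.1 he).2
  have h := Finset.card_le_card this
  rw [Finset.card_powersetCard, Finset.card_univ, Fintype.card_fin] at h
  exact_mod_cast h

/-- The complete `R`-graph on `n` vertices. -/
def complete (R : Finset ℕ) (n : ℕ) : RGraph R n where
  edges := Finset.univ.filter fun e => e.card ∈ R
  card_mem _ he := (Finset.mem_filter.1 he).2

theorem lubell_complete {n : ℕ} (hn : R.sup id ≤ n) : (complete R n).lubell = R.card := by
  rw [lubell_eq_sum_card, ← mul_one (R.card : ℝ), ← nsmul_eq_mul, ← Finset.sum_const]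
  refine Finset.sum_congr rfl fun k hk => ?_
  have hkn : k ≤ n := (Finset.le_sup (f := id) hk).trans hn
  have : ((complete R n).edges.filter fun e => e.card = k) = Finset.univ.powersetCard k := by
    ext e
    simp only [complete, Finset.mem_filter, Finset.mem_univ, true_and, Finset.mem_powersetCard_univ]
    exact ⟨fun h => h.2, fun h => ⟨h ▸ hk, h⟩⟩
  rw [this, Finset.card_powersetCard, Finset.card_univ, Fintype.card_fin]
  exact div_self (by exact_mod_cast (Nat.choose_pos hkn).ne')

/-- The empty `R`-graph on `n` vertices. -/
def empty (R : Finset ℕ) (n : ℕ) : RGraph R n where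
  edges := ∅
  card_mem _ he := by simp at he

theorem lubell_eq_zero_of_isContained_empty {m n : ℕ} {H : RGraph R m}
    (h : H.IsContained (empty R n)) : H.lubell = 0 := by
  obtain ⟨φ, hφ⟩ := h
  exact Finset.sum_eq_zero fun e he => absurd (hφ e he) (by simp [empty])

/-- Supersaturation combined with blow-up: beyond the Turán density of a finite family, a large
hypergraph contains all the blow-ups on `t` vertices of some member of the family. Indeed, for a
suitable `T`, a positive proportion of the `T`-tuples of vertices span a copy of a member, and for a
positive proportion this is the same member in the same position. -/
theorem exists_forall_comap_isContained (𝓕 : Finset (Σ m, RGraph R m)) {β : ℝ}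
    (hβ : turanDensity (𝓕 : Set (Σ m, RGraph R m)) < β) {t : ℕ} (ht : 0 < t) :
    ∃ n₀ : ℕ, ∀ n : ℕ, n₀ ≤ n → ∀ G : RGraph R n, β ≤ G.lubell →
      ∃ F ∈ 𝓕, ∀ φ : Fin t → Fin F.1, (F.2.comap φ).IsContained G := by
  classical
  obtain ⟨b, hb1, hb2⟩ := exists_between hβ
  obtain ⟨T, hT1, hT2⟩ := (((tendsto_turanMax (𝓕 : Set (Σ m, RGraph R m))).eventually_lt_const
    hb1).and (eventually_ge_atTop (R.sup id))).exists
  have hb0 : 0 ≤ b := (turanMax_nonneg _ _).trans hT1.le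
  -- the possible positions of a member of the family on `T` vertices
  let I := (F : 𝓕) × (Fin F.1.1 ↪ Fin T)
  let K := Fintype.card I
  have hβb : 0 < β - b := sub_pos.2 hb2
  -- `2 ^ T` accounts for the tuples with repetitions; `K` and `R.card` may vanish, hence the `+ 1`s
  have hδ : 0 < (β - b) / (R.card + 1) / (K + 1) / 2 ^ T := by positivity
  obtain ⟨n₁, hn₁⟩ := exists_box_of_dense t T hδ
  set δ := (β - b) / (R.card + 1) / (K + 1) / 2 ^ T with hδdef
  refine ⟨max n₁ (max (2 * T) 1), fun n hn G hG => ?_⟩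
  simp only [max_le_iff] at hn
  have hn0 : (0 : ℝ) < n := by exact_mod_cast hn.2.2
  have hN : ((n : ℝ) / 2) ^ T ≤ Fintype.card (Fin T ↪ Fin n) := by
    rw [Fintype.card_embedding_eq, Fintype.card_fin, Fintype.card_fin]
    have h1 : (((n + 1 - T : ℕ) : ℝ)) ^ T ≤ n.descFactorial T := by
      exact_mod_cast Nat.pow_sub_le_descFactorial n T
    refine le_trans (pow_le_pow_left₀ (by positivity) ?_ _) h1
    have h2 : (n : ℝ) ≤ 2 * ((n + 1 - T : ℕ) : ℝ) := by
      exact_mod_cast (by omega : n ≤ 2 * (n + 1 - T))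
    linarith
  have hB := sum_le_card_filter_mul_add (Finset.univ : Finset (Fin T ↪ Fin n))
    (fun w => (G.comap w).lubell) (M := R.card + 1) hb0
    (fun w _ => (lubell_le_card _).trans (by linarith))
  rw [sum_lubell_comap_embedding hT2, Finset.card_univ] at hB
  set B := (Finset.univ : Finset (Fin T ↪ Fin n)).filter
    fun w : Fin T ↪ Fin n => b < (G.comap w).lubell with hBdef
  let P : I → Finset (Fin T ↪ Fin n) := fun p =>
    Finset.univ.filter fun w => ∀ e ∈ p.1.1.2.edges, e.map p.2 ∈ (G.comap w).edges
  have hcov : B ⊆ Finset.univ.biUnion P := by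
    intro w hw
    have hw := (Finset.mem_filter.1 hw).2
    have : ¬ (G.comap w).IsFree (𝓕 : Set (Σ m, RGraph R m)) := fun hfree =>
      (hT1.trans hw).not_ge (le_csSup (finite_lubell _ _).bddAbove ⟨_, hfree, rfl⟩)
    simp only [IsFree, not_forall, not_not] at this
    obtain ⟨F, hF, ψ, hψ⟩ := this
    exact Finset.mem_biUnion.2 ⟨⟨⟨F, hF⟩, ψ⟩, Finset.mem_univ _,
      Finset.mem_filter.2 ⟨Finset.mem_univ _, hψ⟩⟩
  have hBlow : (K + 1) * (δ * (n : ℝ) ^ T) ≤ B.card := by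
    have h1 : ((n : ℝ) / 2) ^ T * (β - b) ≤ B.card * (R.card + 1) := by
      calc ((n : ℝ) / 2) ^ T * (β - b) ≤ Fintype.card (Fin T ↪ Fin n) * (β - b) := by gcongr
        _ ≤ Fintype.card (Fin T ↪ Fin n) * (G.lubell - b) := by gcongr
        _ ≤ _ := by linarith
    refine le_of_mul_le_mul_right (le_trans (le_of_eq ?_) h1)
      (by positivity : (0 : ℝ) < R.card + 1)
    rw [hδdef, div_pow]
    field_simp
  obtain ⟨p, hp⟩ : ∃ p, δ * (n : ℝ) ^ T ≤ (P p).card := by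
    by_contra! hlt
    have h1 : (B.card : ℝ) ≤ ∑ p, ((P p).card : ℝ) := by
      exact_mod_cast (Finset.card_le_card hcov).trans Finset.card_biUnion_le
    have h2 : ∑ p, ((P p).card : ℝ) ≤ K * (δ * (n : ℝ) ^ T) := by
      refine (Finset.sum_le_card_nsmul _ _ _ fun p _ => (hlt p).le).trans ?_
      rw [nsmul_eq_mul, Finset.card_univ]
    have h3 : 0 < δ * (n : ℝ) ^ T := by positivity
    linarith
  obtain ⟨u, hu⟩ := hn₁ n hn.1 ((P p).map ⟨fun w : Fin T ↪ Fin n => ⇑w, DFunLike.coe_injective⟩)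
    (by rwa [Finset.card_map])
  refine ⟨p.1.1, p.1.2, comap_isContained_of_box ht p.2 u (fun s => ?_) fun s e he => ?_⟩
  · obtain ⟨w, -, hw⟩ := Finset.mem_map.1 (hu s)
    rw [← hw]
    exact w.injective
  · obtain ⟨w, hwP, hw⟩ := Finset.mem_map.1 (hu s)
    have h1 := (mem_edges_comap.1 ((Finset.mem_filter.1 hwP).2 e he)).2
    rw [Finset.map_eq_image, Finset.image_image] at h1
    convert h1 using 1
    refine Finset.image_congr fun i _ => ?_
    exact (congrFun hw (p.2 i)).symm

theorem exists_isContained_of_turanDensity_lt (𝓕 : Finset (Σ m, RGraph R m)) {β l : ℝ}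
    (hβ : turanDensity (𝓕 : Set (Σ m, RGraph R m)) < β) (hl : ∀ F ∈ 𝓕, l ≤ F.2.lagrangian)
    (hm : ∀ F ∈ 𝓕, 0 < F.1) {t : ℕ} (ht : 0 < t) (htR : R.sup id ≤ t) :
    ∃ n₀ : ℕ, ∀ n : ℕ, n₀ ≤ n → ∀ G : RGraph R n, β ≤ G.lubell →
      ∃ H : RGraph R t, H.IsContained G ∧ l ≤ H.lubell := by
  obtain ⟨n₀, hn₀⟩ := exists_forall_comap_isContained 𝓕 hβ ht
  refine ⟨n₀, fun n hn G hG => ?_⟩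
  obtain ⟨F, hF, h⟩ := hn₀ n hn G hG
  obtain ⟨φ, hφ⟩ := exists_lagrangian_le_lubell_comap htR (hm F hF) F.2
  exact ⟨_, h φ, (hl F hF).trans hφ⟩

/-! ### The family defined by a jump -/

/-- The value at the barycentre of the simplex bounds the Lagrangian from below. -/
theorem mul_lubell_le_lagrangian {t : ℕ} (ht : 0 < t) (htR : R.sup id ≤ t) (H : RGraph R t) :
    (1 - ((R.sup id : ℕ) : ℝ) ^ 2 / t) * H.lubell ≤ H.lagrangian := by
  have ht0 : (0 : ℝ) < t := by exact_mod_cast ht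
  have hmem : (fun _ => 1 / (t : ℝ)) ∈ stdSimplex ℝ (Fin t) := by
    refine ⟨fun _ => by positivity, ?_⟩
    simp [ht0.ne']
  refine le_trans ?_ ((isGreatest_lagrangian ht H).2 ⟨_, hmem, rfl⟩)
  rw [lubell, polyForm, Finset.mul_sum]
  refine Finset.sum_le_sum fun e he => ?_
  have hk : e.card ≤ R.sup id := Finset.le_sup (f := id) (H.card_mem e he)
  rw [Finset.prod_const]
  set k := e.card
  have hc : (0 : ℝ) < t.choose k := by exact_mod_cast Nat.choose_pos (hk.trans htR)
  rw [mul_one_div, div_le_iff₀ hc, mul_right_comm, ← Nat.cast_mul,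
    ← Nat.descFactorial_eq_factorial_mul_choose]
  have hkt : (k : ℝ) ≤ t := by exact_mod_cast hk.trans htR
  have hkR : (k : ℝ) ^ 2 ≤ ((R.sup id : ℕ) : ℝ) ^ 2 := by gcongr
  calc (1 - ((R.sup id : ℕ) : ℝ) ^ 2 / t) ≤ 1 + k * (-(k / t)) := by
        have : (k : ℝ) ^ 2 / t ≤ ((R.sup id : ℕ) : ℝ) ^ 2 / t := by gcongr
        have h2 : (k : ℝ) * (-(k / t)) = - ((k : ℝ) ^ 2 / t) := by ring
        linarith
    _ ≤ (1 + -(k / t)) ^ k := by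
        refine one_add_mul_le_pow ?_ k
        have : (k : ℝ) / t ≤ 1 := (div_le_one ht0).2 hkt
        linarith
    _ = ((t : ℝ) - k) ^ k * (1 / t) ^ k := by
        rw [← mul_pow]
        congr 1
        field_simp
        ring
    _ ≤ (t.descFactorial k : ℝ) * (1 / t) ^ k := by
        gcongr
        have h1 : (((t + 1 - k : ℕ) : ℝ)) ^ k ≤ t.descFactorial k := by
          exact_mod_cast Nat.pow_sub_le_descFactorial t k
        refine le_trans (pow_le_pow_left₀ (by linarith) ?_ _) h1
        rw [Nat.cast_sub (by omega)]
        push_cast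
        linarith

theorem turanDensity_le {𝓕 : Set (Σ m, RGraph R m)} {b : ℝ} (hb : 0 ≤ b)
    (h : ∃ n₀ : ℕ, ∀ n : ℕ, n₀ ≤ n → ∀ G : RGraph R n, G.IsFree 𝓕 → G.lubell ≤ b) :
    turanDensity 𝓕 ≤ b := by
  obtain ⟨n₀, hn₀⟩ := h
  refine le_of_tendsto (tendsto_turanMax 𝓕) ?_
  filter_upwards [eventually_ge_atTop n₀] with n hn
  refine Real.sSup_le ?_ hb
  rintro _ ⟨G, hG, rfl⟩
  exact hn₀ n hn G hG

/-- For large `t` the `R`-graphs on `t` vertices with Lubell value at least `α + c` form a finite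
nonempty family whose members have Lagrangian greater than `α`. -/
theorem exists_family {α c : ℝ} (hc : 0 < c) (hcR : α + c ≤ R.card) :
    ∃ t : ℕ, R.sup id ≤ t ∧ ∃ (𝓕 : Finset (Σ m, RGraph R m)) (h𝓕 : 𝓕.Nonempty),
      α < 𝓕.inf' h𝓕 (fun F => F.2.lagrangian) ∧
      ∀ H : RGraph R t, α + c ≤ H.lubell → (⟨t, H⟩ : Σ m, RGraph R m) ∈ 𝓕 := by
  classical
  have hlim : Tendsto (fun t : ℕ => (1 - ((R.sup id : ℕ) : ℝ) ^ 2 / t) * (α + c)) atTop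
      (𝓝 ((1 - 0) * (α + c))) :=
    (tendsto_const_nhds.sub (tendsto_const_div_atTop_nhds_zero_nat _)).mul_const _
  obtain ⟨t, ht1, htR, ht0, htR2⟩ := ((hlim.eventually_const_lt (u := α) (by linarith)).and
    ((eventually_ge_atTop (R.sup id)).and ((eventually_gt_atTop 0).and
      (eventually_ge_atTop (R.sup id ^ 2))))).exists
  have hfin : Finite (RGraph R t) :=
    Finite.of_injective (fun G : RGraph R t => G.edges) fun _ _ h => RGraph.ext h
  have hS := (Set.toFinite {H : RGraph R t | α + c ≤ H.lubell}).image
    fun H => (⟨t, H⟩ : Σ m, RGraph R m)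
  have hmem : ∀ H : RGraph R t, α + c ≤ H.lubell → (⟨t, H⟩ : Σ m, RGraph R m) ∈ hS.toFinset :=
    fun H hH => hS.mem_toFinset.2 ⟨H, hH, rfl⟩
  refine ⟨t, htR, hS.toFinset, ⟨_, hmem (complete R t) ?_⟩, ?_, hmem⟩
  · rwa [lubell_complete htR]
  · refine (Finset.lt_inf'_iff _).2 fun F hF => ?_
    obtain ⟨H, hH, rfl⟩ := hS.mem_toFinset.1 hF
    refine ht1.trans_le (le_trans ?_ (mul_lubell_le_lagrangian ht0 htR H))
    refine mul_le_mul_of_nonneg_left hH (sub_nonneg.2 (div_le_one_of_le₀ ?_ (by positivity)))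
    exact_mod_cast htR2

end RGraph

/-! ### Jumps and families -/

theorem theorem4 (R : Finset ℕ) (hR : ∀ r ∈ R, 0 < r) (α : ℝ) (hα : 0 ≤ α)
    (hα' : α < (R.card : ℝ)) :
    (RGraph.IsJump R α ↔
      ∃ (𝓕 : Finset (Σ m, RGraph R m)) (h𝓕 : 𝓕.Nonempty),
        RGraph.turanDensity (𝓕 : Set (Σ m, RGraph R m)) ≤ α ∧
        α < 𝓕.inf' h𝓕 (fun F => F.2.lagrangian)) ∧
    (RGraph.IsStrongJump R α ↔
      ∃ (𝓕 : Finset (Σ m, RGraph R m)) (h𝓕 : 𝓕.Nonempty),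
        RGraph.turanDensity (𝓕 : Set (Σ m, RGraph R m)) < α ∧
        α < 𝓕.inf' h𝓕 (fun F => F.2.lagrangian)) := by
  have hsup : 0 < R.sup id := by
    have hne : R.Nonempty := by
      rw [← Finset.card_pos]
      exact_mod_cast hα.trans_lt hα'
    obtain ⟨r, hr⟩ := hne
    exact (hR r hr).trans_le (Finset.le_sup (f := id) hr)
  -- a hypergraph without vertices has Lagrangian `0`, so it is not in the family
  have hpos : ∀ F : Σ m, RGraph R m, α < F.2.lagrangian → 0 < F.1 := by
    rintro ⟨m, F⟩ hF
    rcases Nat.eq_zero_or_pos m with rfl | hm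
    · simp only [RGraph.lagrangian, stdSimplex_of_isEmpty_index, Set.image_empty,
        Real.sSup_empty] at hF
      exact absurd hF hα.not_gt
    · exact hm
  refine ⟨⟨?_, ?_⟩, ⟨?_, ?_⟩⟩
  · rintro ⟨c, hc, hjump⟩
    obtain ⟨t, htR, 𝓕, h𝓕, hlam, hmem⟩ := RGraph.exists_family (α := α)
      (lt_min hc (sub_pos.2 hα')) (by linarith [min_le_right c ((R.card : ℝ) - α)])
    refine ⟨𝓕, h𝓕, le_of_forall_pos_le_add fun ε hε => ?_, hlam⟩
    obtain ⟨n₀, hn₀⟩ := hjump ε hε t htR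
    refine RGraph.turanDensity_le (by positivity) ⟨n₀, fun n hn G hG => ?_⟩
    by_contra! hlt
    obtain ⟨H, hHG, hH⟩ := hn₀ n hn G hlt.le
    exact hG ⟨t, H⟩ (hmem H (by linarith [min_le_left c ((R.card : ℝ) - α)])) hHG
  · rintro ⟨𝓕, h𝓕, hπ, hlam⟩
    refine ⟨𝓕.inf' h𝓕 (fun F => F.2.lagrangian) - α, sub_pos.2 hlam, fun ε hε t htR => ?_⟩
    rw [add_sub_cancel]
    exact RGraph.exists_isContained_of_turanDensity_lt 𝓕 (by linarith)
      (fun F hF => Finset.inf'_le _ hF)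
      (fun F hF => hpos F (hlam.trans_le (Finset.inf'_le _ hF))) (hsup.trans_le htR) htR
  · rintro ⟨c, hc, hjump⟩
    -- the empty hypergraphs have no subgraph of positive Lubell value
    have hcα : 0 < α - c := by
      by_contra! hle
      obtain ⟨n₀, hn₀⟩ := hjump _ le_rfl
      obtain ⟨H, hHG, hH⟩ := hn₀ n₀ le_rfl (RGraph.empty R n₀) (hle.trans (RGraph.lubell_nonneg _))
      rw [RGraph.lubell_eq_zero_of_isContained_empty hHG] at hH
      linarith
    obtain ⟨t, htR, 𝓕, h𝓕, hlam, hmem⟩ := RGraph.exists_family (α := α)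
      (lt_min hc (sub_pos.2 hα')) (by linarith [min_le_right c ((R.card : ℝ) - α)])
    refine ⟨𝓕, h𝓕, lt_of_le_of_lt ?_ (sub_lt_self α hc), hlam⟩
    obtain ⟨n₀, hn₀⟩ := hjump t htR
    refine RGraph.turanDensity_le hcα.le ⟨n₀, fun n hn G hG => ?_⟩
    by_contra! hlt
    obtain ⟨H, hHG, hH⟩ := hn₀ n hn G hlt.le
    exact hG ⟨t, H⟩ (hmem H (by linarith [min_le_left c ((R.card : ℝ) - α)])) hHG
  · rintro ⟨𝓕, h𝓕, hπ, hlam⟩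
    -- `c` has to keep `α - c` above the Turán density and `α + c` below the Lagrangians
    set l := 𝓕.inf' h𝓕 (fun F => F.2.lagrangian) with hl
    set p := RGraph.turanDensity (𝓕 : Set (Σ m, RGraph R m)) with hp
    have h1 := min_le_left (l - α) ((α - p) / 2)
    have h2 := min_le_right (l - α) ((α - p) / 2)
    refine ⟨min (l - α) ((α - p) / 2), lt_min (by linarith) (by linarith), fun t htR => ?_⟩
    exact RGraph.exists_isContained_of_turanDensity_lt 𝓕 (by linarith)
      (fun F hF => (by linarith : _ ≤ l).trans (Finset.inf'_le _ hF))
      (fun F hF => hpos F (hlam.trans_le (Finset.inf'_le _ hF))) (hsup.trans_le htR) htR
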